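/- **Setting.** Fix a horizon $T$ and consider variables $u_i, x_i, v_i, w_i, z_i, y_i$ for $i=1,\dots,T$. Let $\mathcal G$ be one of the following two DAGs on them (edges are present whenever both endpoints exist). - Graph (a) has the edges $u_i\to u_{i+1}$; $u_i\to x_i, v_i, w_i$; $x_i\to z_i, y_i$; $w_i\to z_i$; $v_i\to y_i$; $z_i\to y_i$; $z_i\to z_{i+1}$; $y_i\to y_{i+1}$; $y_i\to z_{i+1}$. - Graph (b) has in addition $x_i\to x_{i+1}$, $v_i\to v_{i+1}$, $w_i\to w_{i+1}$. Consider a structural causal model with graph $\mathcal G$: every variable is a measurable function of its parents and its own noise variable, and the noise variables are independent. The $u_i$ take values in an arbitrary measurable space; $x_i,v_i,w_i,z_i,y_i$ take values in countable (for example finite) sets. Let $p$ be the joint law of all $x_i,v_i,w_i,z_i,y_i$, and let $p(\cdot\mid \operatorname{do}(\cdot))$ be their law after the equations of the intervened variables are replaced by constants. Let $S_s=\{y_{1:s},x_{1:s},v_{1:s},w_{1:s}\}$, $a(z_j)=p(z_j\mid x_j,w_j,z_{j-1},y_{j-1})$ and $b(y_j)=p(y_j\mid z_j,x_j,v_j,y_{j-1})$;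 for $j=1$ the variables at time $0$ are omitted, and $S_0=\emptyset$. **Proposition (Long term causal effects of recurring interventions).** Let $t\ge 1$, $k\ge 0$, $t+k\le T$, and $C=\{v_{t:t+k},w_{t:t+k},z_{t-1},S_{t-1}\}$ (without $z_{t-1}$ if $t=1$). Let $x_{t:t+k}$ be values such that $p(x_{t:t+k},C)>0$ for all values of $C$ with $p(C)>0$. Then, for all values of $y_{t+k}$ and $z_{t+k}$, the causal effect of $x_{t:t+k}$ is given by back-door adjustment on $C$: $$p(y_{t+k},z_{t+k}\mid \operatorname{do}(x_{t:t+k}))=\sum_C p(y_{t+k},z_{t+k}\mid x_{t:t+k},C)\,p(C)=\sum_C\Bigl[\sum_{y_{t:t+k-1},\,z_{t:t+k-1}}\ \prod_{j=t}^{t+k} b(y_j)\,a(z_j)\Bigr]p(C).$$ (Terms with $p(C)=0$ are zero; in the inner sum, a conditional probability given an event of probability $0$ is read as $0$.) In particular the effect is identifiable from $\mathcal G$: any two such models with the same graph and the same $p$ have the same $p(y_{t+k},z_{t+k}\mid \operatorname{do}(x_{t:t+k}))$. Furthermore, $$p(y_{t+k}\mid \operatorname{do}(x_{t:t+k}))=\sum_{z_{t+k}}p(y_{t+k},z_{t+k}\mid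 \operatorname{do}(x_{t:t+k})),$$ and, where the denominator is positive, $$p(y_{t+k}\mid \operatorname{do}(x_{t:t+k}),z_{t+k})=\frac{p(y_{t+k},z_{t+k}\mid \operatorname{do}(x_{t:t+k}))}{\sum_{y_{t+k}}p(y_{t+k},z_{t+k}\mid \operatorname{do}(x_{t:t+k}))}.$$ -/

import Mathlib

open MeasureTheory ProbabilityTheory

universe u v

noncomputable section

/-! Structural causal models over a directed acyclic graph -/

/-- A directed acyclic graph on the nodes `N` (on a finite node set, well-foundedness of the
edge relation is the absence of directed cycles). -/
structure DAG (N : Type) where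
  Edge : N → N → Prop
  wf : WellFounded Edge

/-- A structural causal model with causal graph `G`, in which node `n` takes values in `Val n`:
each node is a measurable function of its parents in `G` and of its own exogenous noise variable.
The noise variables of different nodes are independent, that of node `n` has law `noiseLaw n`. -/
structure SCM {N : Type} (G : DAG N) (Val : N → Type u) [∀ n, MeasurableSpace (Val n)] where
  Noise : N → Type v
  [measNoise : ∀ n, MeasurableSpace (Noise n)]
  noiseLaw : ∀ n, Measure (Noise n)
  [prob : ∀ n, IsProbabilityMeasure (noiseLaw n)]
  f : ∀ n, (∀ p : {p // G.Edge p n}, Val p) → Noise n → Val n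
  measurable_f : ∀ n, Measurable fun q : (∀ p : {p // G.Edge p n}, Val p) × Noise n => f n q.1 q.2

attribute [instance] SCM.measNoise SCM.prob

namespace SCM

variable {N : Type} {G : DAG N} {Val : N → Type u} [∀ n, MeasurableSpace (Val n)]

/-- The values of all nodes, given all noise values, after the intervention `I`: a node `n` with
`I n = some a` is set to the constant `a`, every other node keeps its structural equation. -/
def solve (M : SCM.{u, v} G Val) (I : ∀ n, Option (Val n)) (ε : ∀ n, M.Noise n) : ∀ n, Val n :=
  G.wf.fix fun n rec => (I n).getD (M.f n (fun p => rec p.1 p.2) (ε n))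

theorem solve_eq (M : SCM.{u, v} G Val) (I : ∀ n, Option (Val n)) (ε : ∀ n, M.Noise n) (n : N) :
    M.solve I ε n = (I n).getD (M.f n (fun p => M.solve I ε p.1) (ε n)) :=
  WellFounded.fix_eq _ _ _

theorem measurable_solve (M : SCM.{u, v} G Val) (I : ∀ n, Option (Val n)) :
    Measurable (M.solve I) := by
  refine measurable_pi_lambda _ fun n => ?_
  induction n using G.wf.induction with
  | _ n ih =>
    have h : (fun ε => M.solve I ε n) =
        fun ε => (I n).getD (M.f n (fun p => M.solve I ε p.1) (ε n)) :=
      funext fun ε => M.solve_eq I ε n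
    rw [h]
    cases I n with
    | some a => exact measurable_const
    | none =>
      exact (M.measurable_f n).comp
        ((measurable_pi_lambda _ fun p : {p // G.Edge p n} => ih p.1 p.2).prodMk
          (measurable_pi_apply n))

/-- The joint law of all nodes under the intervention `I`. -/
def law [Fintype N] (M : SCM.{u, v} G Val) (I : ∀ n, Option (Val n)) : Measure (∀ n, Val n) :=
  (Measure.pi M.noiseLaw).map (M.solve I)

end SCM

/-! The two causal graphs of the FAN-HMM -/

/-- Response `y`, hidden state `z`, covariates `x`, `v`, `w`. -/
inductive Ob
  | x | v | w | z | y
  deriving DecidableEq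

instance Ob.instFintype : Fintype Ob :=
  ⟨{.x, .v, .w, .z, .y}, fun o => by cases o <;> decide⟩

/-- The variables of the causal graphs: those above, and the common cause `u` of the covariates. -/
inductive Var
  | u
  | obs (o : Ob)
  deriving DecidableEq

instance Var.instFintype : Fintype Var :=
  ⟨insert .u (Finset.univ.image .obs), fun κ => by cases κ <;> simp⟩

/-- Time points `1, …, T`. -/
abbrev Time (T : ℕ) : Type := ↥(Finset.Icc 1 T)

/-- All nodes of the causal graphs. -/
abbrev Node (T : ℕ) : Type := Var × Time T

/-- All nodes except the `u`'s. -/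
abbrev ObNode (T : ℕ) : Type := Ob × Time T

/-- The two graphs: in `a` the covariates depend on each other only through `u`; in `b` each
covariate also depends on its own previous value. -/
inductive GraphKind
  | a | b

/-- There is an edge from `m` to `n`. -/
def FanEdge (g : GraphKind) {T : ℕ} (m n : Node T) : Prop :=
  match m.1, n.1 with
  | .u, .u => m.2.1 + 1 = n.2.1
  | .u, .obs .x => m.2.1 = n.2.1
  | .u, .obs .v => m.2.1 = n.2.1
  | .u, .obs .w => m.2.1 = n.2.1
  | .obs .x, .obs .z => m.2.1 = n.2.1
  | .obs .x, .obs .y => m.2.1 = n.2.1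
  | .obs .v, .obs .y => m.2.1 = n.2.1
  | .obs .w, .obs .z => m.2.1 = n.2.1
  | .obs .z, .obs .y => m.2.1 = n.2.1
  | .obs .z, .obs .z => m.2.1 + 1 = n.2.1
  | .obs .y, .obs .y => m.2.1 + 1 = n.2.1
  | .obs .y, .obs .z => m.2.1 + 1 = n.2.1
  | .obs .x, .obs .x => g = .b ∧ m.2.1 + 1 = n.2.1
  | .obs .v, .obs .v => g = .b ∧ m.2.1 + 1 = n.2.1
  | .obs .w, .obs .w => g = .b ∧ m.2.1 + 1 = n.2.1
  | _, _ => False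

/-- The position of a variable in the causal order within one time point. -/
def Var.level : Var → ℕ
  | .u => 0
  | .obs .x => 1
  | .obs .v => 1
  | .obs .w => 1
  | .obs .z => 2
  | .obs .y => 3

theorem FanEdge.lt {g : GraphKind} {T : ℕ} {m n : Node T} (h : FanEdge g m n) :
    4 * m.2.1 + m.1.level < 4 * n.2.1 + n.1.level := by
  obtain ⟨κ, i⟩ := m
  obtain ⟨l, j⟩ := n
  rcases κ with _ | κ <;> rcases l with _ | l <;> try cases κ
  all_goals try cases l
  all_goals simp only [FanEdge, Var.level] at h ⊢
  all_goals omega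

/-- The causal graph of the FAN-HMM over the time points `1, …, T`. -/
def fanGraph (g : GraphKind) (T : ℕ) : DAG (Node T) where
  Edge := FanEdge g
  wf := Subrelation.wf FanEdge.lt
    (InvImage.wf (fun n : Node T => 4 * n.2.1 + n.1.level) wellFounded_lt)

/-- Value spaces: `u` takes values in `U`, the variable `o` in `O o`. -/
def Val (U : Type u) (O : Ob → Type u) : Var → Type u
  | .u => U
  | .obs o => O o

instance Val.instMeasurableSpace (U : Type u) (O : Ob → Type u) [MeasurableSpace U]
    [∀ o, MeasurableSpace (O o)] : ∀ κ, MeasurableSpace (Val U O κ)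
  | .u => inferInstanceAs (MeasurableSpace U)
  | .obs o => inferInstanceAs (MeasurableSpace (O o))

/-- Structural causal models whose causal graph is the graph `g` over the times `1, …, T`. -/
abbrev FanSCM (g : GraphKind) (T : ℕ) (U : Type u) (O : Ob → Type u) [MeasurableSpace U]
    [∀ o, MeasurableSpace (O o)] : Type (max u (v + 1)) :=
  SCM.{u, v} (fanGraph g T) (fun n : Node T => Val U O n.1)

/-! Assignments of values, events, observational and interventional laws -/

/-- Values for all variables of the set `A`. -/
abbrev Asg {T : ℕ} (O : Ob → Type u) (A : Set (ObNode T)) : Type u := ∀ n : A, O n.1.1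

/-- The intervention that sets the variables of `A` to the values `a`. -/
def intervene {T : ℕ} (U : Type u) {O : Ob → Type u} {A : Set (ObNode T)} (a : Asg O A) :
    ∀ n : Node T, Option (Val U O n.1)
  | (.u, _) => none
  | (.obs o, i) => open Classical in if h : (o, i) ∈ A then some (a ⟨(o, i), h⟩) else none

section

variable {g : GraphKind} {T : ℕ} {U : Type u} {O : Ob → Type u} [MeasurableSpace U]
  [∀ o, MeasurableSpace (O o)]

/-- Joint law of all variables but the `u`'s under an intervention. -/
def FanSCM.lawOf (M : FanSCM.{u, v} g T U O) (I : ∀ n : Node T, Option (Val U O n.1)) :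
    Measure (∀ n : ObNode T, O n.1) :=
  (M.law I).map fun ω n => ω (.obs n.1, n.2)

/-- The observational law `p` (no intervention). -/
def FanSCM.obsLaw (M : FanSCM.{u, v} g T U O) : Measure (∀ n : ObNode T, O n.1) :=
  FanSCM.lawOf M fun _ => none

/-- The interventional law `p(· ∣ do(A = a))`. -/
def FanSCM.doLaw (M : FanSCM.{u, v} g T U O) {A : Set (ObNode T)} (a : Asg O A) :
    Measure (∀ n : ObNode T, O n.1) :=
  FanSCM.lawOf M (intervene U a)

end

/-- The event that all variables of `A` have the values `a`. -/
def ev {T : ℕ} {O : Ob → Type u} {A : Set (ObNode T)} (a : Asg O A) :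
    Set (∀ n : ObNode T, O n.1) :=
  {ω | ∀ n : A, ω n = a n}

/-- The event that those variables of `A` that lie in `B` have the values `a`. -/
def evOn {T : ℕ} {O : Ob → Type u} {A : Set (ObNode T)} (a : Asg O A) (B : Set (ObNode T)) :
    Set (∀ n : ObNode T, O n.1) :=
  {ω | ∀ n : A, n.1 ∈ B → ω n = a n}

/-! The sets of variables in the adjustment formula -/

/-- `x_{t:t+k}` -/
def xWin (T t k : ℕ) : Set (ObNode T) := {n | n.1 = .x ∧ t ≤ n.2.1 ∧ n.2.1 ≤ t + k}

/-- `S_s = {y_{1:s}, x_{1:s}, v_{1:s}, w_{1:s}}` for `s = t - 1`, empty if `t = 1`. -/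
def past (T t : ℕ) : Set (ObNode T) := {n | n.1 ≠ .z ∧ n.2.1 + 1 ≤ t}

/-- `C = {v_{t:t+k}, w_{t:t+k}, z_{t-1}, S_{t-1}}` (no `z_{t-1}` if `t = 1`). -/
def adjSet (T t k : ℕ) : Set (ObNode T) :=
  {n | (n.1 = .v ∨ n.1 = .w) ∧ t ≤ n.2.1 ∧ n.2.1 ≤ t + k} ∪
    {n | n.1 = .z ∧ n.2.1 + 1 = t} ∪ past T t

/-- `{y_{t:t+k-1}, z_{t:t+k-1}}`, empty if `k = 0`. -/
def midSet (T t k : ℕ) : Set (ObNode T) :=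
  {n | (n.1 = .y ∨ n.1 = .z) ∧ t ≤ n.2.1 ∧ n.2.1 < t + k}

/-- The single variable `o` at time `i`. -/
def atTime (T : ℕ) (o : Ob) (i : ℕ) : Set (ObNode T) := {n | n.1 = o ∧ n.2.1 = i}

/-- `{x_j, w_j, z_{j-1}, y_{j-1}}` (only `{x_j, w_j}` if `j = 1`). -/
def zCond (T j : ℕ) : Set (ObNode T) :=
  atTime T .x j ∪ atTime T .w j ∪ {n | (n.1 = .z ∨ n.1 = .y) ∧ n.2.1 + 1 = j}

/-- `{z_j, x_j, v_j, y_{j-1}}` (only `{z_j, x_j, v_j}` if `j = 1`). -/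
def yCond (T j : ℕ) : Set (ObNode T) :=
  atTime T .z j ∪ atTime T .x j ∪ atTime T .v j ∪ {n | n.1 = .y ∧ n.2.1 + 1 = j}

/-! The adjustment formula, as a functional of the law `p` of all variables but the `u`'s -/

section

variable {T : ℕ} {O : Ob → Type u} [∀ o, MeasurableSpace (O o)]

/-- `∑_C p(y_{t+k}, z_{t+k} ∣ x_{t:t+k}, C) p(C)` -/
def backdoor (p : Measure (∀ n : ObNode T, O n.1)) (t k : ℕ) (x : Asg O (xWin T t k))
    (y : Asg O (atTime T .y (t + k))) (z : Asg O (atTime T .z (t + k))) : ENNReal :=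
  ∑' c : Asg O (adjSet T t k), p[ev y ∩ ev z | ev x ∩ ev c] * p (ev c)

/-- The event that the variables of `B` have the values listed in `x, c, m, y, z`, which together
give values to all variables that occur in the adjustment formula. -/
def fixOn {t k : ℕ} (x : Asg O (xWin T t k)) (c : Asg O (adjSet T t k)) (m : Asg O (midSet T t k))
    (y : Asg O (atTime T .y (t + k))) (z : Asg O (atTime T .z (t + k))) (B : Set (ObNode T)) :
    Set (∀ n : ObNode T, O n.1) :=
  evOn x B ∩ evOn c B ∩ evOn m B ∩ evOn y B ∩ evOn z B

/-- `∑_C [∑_{y_{t:t+k-1}, z_{t:t+k-1}} ∏_{j=t}^{t+k} b(y_j) a(z_j)] p(C)` with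
`a(z_j) = p(z_j ∣ x_j, w_j, z_{j-1}, y_{j-1})` and `b(y_j) = p(y_j ∣ z_j, x_j, v_j, y_{j-1})`. -/
def seqAdjust (p : Measure (∀ n : ObNode T, O n.1)) (t k : ℕ) (x : Asg O (xWin T t k))
    (y : Asg O (atTime T .y (t + k))) (z : Asg O (atTime T .z (t + k))) : ENNReal :=
  ∑' c : Asg O (adjSet T t k),
    (∑' m : Asg O (midSet T t k), ∏ j ∈ Finset.Icc t (t + k),
      p[fixOn x c m y z (atTime T .y j) | fixOn x c m y z (yCond T j)] *
        p[fixOn x c m y z (atTime T .z j) | fixOn x c m y z (zCond T j)]) * p (ev c)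

end

end

/-! Each `z_j` and `y_j` is driven by its own noise and by observed parents only; `u` is a parent of
neither. Take a set of variables that contains the parents of such a node and lies in an ancestral
set without the node. Adding the node multiplies the probability by a kernel in which the
intervention does not appear (`SCM.law_agreeOn_insert`). Adding `z_t, y_t, z_{t+1}, …` to
`x_{t:t+k}` and `C` one by one gives the same product of kernels under `p` and under the
intervention (`lawOf_window`).

Only the initial factor differs. Under the intervention it is `p(C)`, because `x` is forced and `C`
contains no descendant of the intervened nodes (`doLaw_ev_adjSet`). Under `p` it is `p(x, C)`, which
conditioning cancels by positivity. The one-step rule applied to the parents alone identifies the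
kernels with `a(z_j)` and `b(y_j)`. All three expressions thus equal one sum of kernels, and
identifiability follows because the adjustment formula depends on `p` only. -/

noncomputable section

/-! ### Cylinder events and independence of coordinates -/

/-- The functions that agree with `a` on the set `B`. -/
def agreeOn {ι : Type*} {α : ι → Type*} (a : ∀ i, α i) (B : Set ι) : Set (∀ i, α i) :=
  {ω | ∀ i ∈ B, ω i = a i}

section agreeOn

variable {ι : Type*} {α : ι → Type*} (a : ∀ i, α i)

theorem agreeOn_union (A B : Set ι) : agreeOn a (A ∪ B) = agreeOn a A ∩ agreeOn a B := by
  ext ω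
  simp only [agreeOn, Set.mem_union, Set.mem_ofPred_eq, Set.mem_inter_iff, or_imp, forall_and]

theorem agreeOn_insert (i : ι) (B : Set ι) :
    agreeOn a (insert i B) = agreeOn a B ∩ {ω | ω i = a i} := by
  ext ω
  simp only [agreeOn, Set.mem_insert_iff, Set.mem_ofPred_eq, Set.mem_inter_iff, or_imp, forall_and,
    forall_eq, and_comm]

theorem agreeOn_anti {A B : Set ι} (h : A ⊆ B) : agreeOn a B ⊆ agreeOn a A :=
  fun _ hω i hi => hω i (h hi)

theorem measurableSet_agreeOn [Countable ι] [∀ i, MeasurableSpace (α i)] {B : Set ι}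
    (hB : ∀ i ∈ B, MeasurableSet {a i}) : MeasurableSet (agreeOn a B) := by
  have h : agreeOn a B = B.pi fun i => {a i} := by
    ext ω
    simp [agreeOn, Set.mem_pi]
  rw [h]
  exact MeasurableSet.pi B.to_countable hB

end agreeOn

/-- Under a product of probability measures, an event that does not depend on the coordinate `i`
is independent of every event on the coordinate `i`. -/
theorem measure_pi_inter_eval {ι : Type*} [Fintype ι] {X : ι → Type*}
    [∀ i, MeasurableSpace (X i)] (μ : ∀ i, Measure (X i)) [∀ i, IsProbabilityMeasure (μ i)]
    (i : ι) {A : Set (∀ i, X i)} (hA : MeasurableSet A)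
    (hinv : ∀ ε ε' : ∀ i, X i, (∀ j, j ≠ i → ε j = ε' j) → ε ∈ A → ε' ∈ A)
    {B : Set (X i)} (hB : MeasurableSet B) :
    Measure.pi μ (A ∩ {ε | ε i ∈ B}) = Measure.pi μ A * μ i B := by
  classical
  have hne : ∀ j, Nonempty (X j) := fun j => nonempty_of_isProbabilityMeasure (μ j)
  let d : ∀ j, X j := fun j => (hne j).some
  -- Refilling coordinate `i` with a fixed default exhibits `A` as an event in the other
  -- coordinates; by `hinv` the default does not matter.
  let ext : (∀ j : ({i}ᶜ : Finset ι), X j) → ∀ j, X j := fun q j =>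
    if h : j ∈ ({i}ᶜ : Finset ι) then q ⟨j, h⟩ else d j
  have hext : Measurable ext := by
    refine measurable_pi_lambda _ fun j => ?_
    by_cases h : j ∈ ({i}ᶜ : Finset ι)
    · simp only [ext, dif_pos h]
      exact measurable_pi_apply _
    · simp only [ext, dif_neg h]
      exact measurable_const
  have hI : iIndepFun (fun j (ε : ∀ i, X i) => ε j) (Measure.pi μ) :=
    iIndepFun_pi (X := fun _ e => e) fun j => aemeasurable_id
  have hF := hI.indepFun_finset ({i}ᶜ : Finset ι) {i}
    (Finset.disjoint_left.2 fun j hj hj' => by simp_all) fun j => measurable_pi_apply j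
  have hA' : (fun (ε : ∀ i, X i) (j : ({i}ᶜ : Finset ι)) => ε j) ⁻¹' (ext ⁻¹' A) = A := by
    have h : ∀ ε : ∀ i, X i, ∀ j, j ≠ i → ext (fun j => ε j) j = ε j := fun ε j hj =>
      dif_pos (by simpa using hj)
    exact Set.Subset.antisymm (fun ε hε => hinv _ _ (h ε) hε)
      fun ε hε => hinv _ _ (fun j hj => (h ε j hj).symm) hε
  have hB' : (fun (ε : ∀ i, X i) (j : ({i} : Finset ι)) => ε j) ⁻¹'
      ((fun q => q ⟨i, Finset.mem_singleton_self i⟩) ⁻¹' B) = {ε | ε i ∈ B} := rfl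
  have h := hF.measure_inter_preimage_eq_mul _ _ (hext hA)
    ((measurable_pi_apply (⟨i, Finset.mem_singleton_self i⟩ : ({i} : Finset ι))) hB)
  rw [hA', hB'] at h
  rw [h, ← (measurePreserving_eval μ i).measure_preimage hB.nullMeasurableSet]
  rfl

/-! ### Ancestral sets and the one-node factorisation -/

/-- A set of nodes that contains the parents of its members. -/
def DAG.IsAncestral {N : Type} (G : DAG N) (D : Set N) : Prop :=
  ∀ ⦃m n⦄, G.Edge m n → n ∈ D → m ∈ D

namespace SCM

variable {N : Type} {G : DAG N} {Val : N → Type u} [∀ n, MeasurableSpace (Val n)]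

theorem solve_congr (M : SCM.{u, v} G Val) {I I' : ∀ n, Option (Val n)} {ε ε' : ∀ n, M.Noise n}
    {D : Set N} (hD : G.IsAncestral D) (hI : ∀ n ∈ D, I n = I' n) (hε : ∀ n ∈ D, ε n = ε' n)
    {n : N} (hn : n ∈ D) : M.solve I ε n = M.solve I' ε' n := by
  induction n using G.wf.induction with
  | _ n ih =>
    rw [solve_eq, solve_eq, hI n hn, hε n hn]
    have h : (fun p : {p // G.Edge p n} => M.solve I ε p.1) = fun p : {p // G.Edge p n} => M.solve I' ε' p.1 :=
      funext fun p => ih p.1 p.2 (hD p.2 hn)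
    rw [h]

/-- The probability that the node `n` takes the value `a n` when its parents are set to the
values given by `a`. -/
def kernel (M : SCM.{u, v} G Val) (a : ∀ n, Val n) (n : N) : ENNReal :=
  M.noiseLaw n {e | M.f n (fun p => a p.1) e = a n}

variable [Fintype N]

instance (M : SCM.{u, v} G Val) (I : ∀ n, Option (Val n)) : IsProbabilityMeasure (M.law I) :=
  Measure.isProbabilityMeasure_map (M.measurable_solve I).aemeasurable

/-- No node of the ancestral set `D` reads the noise of `n`, so that noise is independent of the
event on `B`. On this event the parents of `n` have the values `a`, and what remains is a condition
on the noise of `n` alone. Hence the new factor is the same for every `I` that leaves `n` free. -/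
theorem law_agreeOn_insert (M : SCM.{u, v} G Val) {I : ∀ n, Option (Val n)} (a : ∀ n, Val n)
    {D B : Set N} (hD : G.IsAncestral D) {n : N} (hn : n ∉ D) (hIn : I n = none) (hBD : B ⊆ D)
    (hpar : ∀ p, G.Edge p n → p ∈ B) (hB : ∀ m ∈ B, MeasurableSet {a m})
    (han : MeasurableSet {a n}) :
    M.law I (agreeOn a (insert n B)) = M.law I (agreeOn a B) * M.kernel a n := by
  have hmB := measurableSet_agreeOn a hB
  have hmI : MeasurableSet (agreeOn a (insert n B)) :=
    measurableSet_agreeOn a (Set.forall_mem_insert.2 ⟨han, hB⟩)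
  have hf : MeasurableSet {e | M.f n (fun p => a p.1) e = a n} :=
    ((M.measurable_f n).comp (measurable_const.prodMk measurable_id)) han
  rw [law, Measure.map_apply (M.measurable_solve I) hmI,
    Measure.map_apply (M.measurable_solve I) hmB, kernel,
    ← measure_pi_inter_eval M.noiseLaw n (M.measurable_solve I hmB) ?_ hf, agreeOn_insert]
  · congr 1
    ext ε
    simp only [Set.mem_preimage, Set.mem_inter_iff, Set.mem_ofPred_eq]
    refine and_congr_right fun hε => ?_
    rw [solve_eq, hIn, Option.getD_none]
    have h : (fun p : {p // G.Edge p n} => M.solve I ε p.1) =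
        fun p : {p // G.Edge p n} => a p.1 :=
      funext fun p => hε p.1 (hpar p.1 p.2)
    rw [h]
  · intro ε ε' h hε m hm
    rw [← hε m hm]
    exact (M.solve_congr hD (fun _ _ => rfl) (fun j hj => h j (ne_of_mem_of_not_mem hj hn))
      (hBD hm)).symm

end SCM

/-! Ancestral sets of the two graphs -/

/-- The edges `z_i → y_i` force `t ≤ s`, and the edges `y_i → z_{i+1}` force `s ≤ t + 1`. -/
theorem isAncestral_response (g : GraphKind) (T s t : ℕ) (hts : t ≤ s) (hst : s ≤ t + 1) :
    (fanGraph g T).IsAncestral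
      {n | (n.1 = .obs .z → n.2.1 < s) ∧ (n.1 = .obs .y → n.2.1 < t)} := by
  rintro ⟨κ, i⟩ ⟨l, j⟩ h hn
  rcases κ with _ | κ <;> rcases l with _ | l <;> try cases κ
  all_goals try cases l
  all_goals simp [fanGraph, FanEdge] at h hn ⊢
  all_goals
    try subst h
    omega

/-- In both graphs `u`, `v` and `w` have no parent among `x`, `z`, `y`, so they may be kept at all
times. The set contains `C` and avoids `x_{t:t+k}`. -/
theorem isAncestral_treatment (g : GraphKind) (T t : ℕ) :
    (fanGraph g T).IsAncestral
      {n | n.1 = .obs .x ∨ n.1 = .obs .z ∨ n.1 = .obs .y → n.2.1 < t} := by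
  rintro ⟨κ, i⟩ ⟨l, j⟩ h hn
  rcases κ with _ | κ <;> rcases l with _ | l <;> try cases κ
  all_goals try cases l
  all_goals simp [fanGraph, FanEdge] at h hn ⊢
  all_goals
    try subst h
    omega

/-- An observed variable as a node of the causal graph. -/
def ObNode.node {T : ℕ} (n : ObNode T) : Node T := (.obs n.1, n.2)

/-- All parents of `z_j` are observed; this keeps the latent `u` out of the kernels. -/
theorem mem_zCond_of_edge {g : GraphKind} {T : ℕ} {j : Time T} {p : Node T}
    (h : (fanGraph g T).Edge p (ObNode.node (.z, j))) : p ∈ ObNode.node '' zCond T j.1 := by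
  obtain ⟨κ, i⟩ := p
  rcases κ with _ | κ <;> try cases κ
  all_goals simp [fanGraph, FanEdge, ObNode.node] at h
  all_goals
    refine ⟨(_, i), ?_, rfl⟩
    simp [zCond, atTime, h]

theorem mem_yCond_of_edge {g : GraphKind} {T : ℕ} {j : Time T} {p : Node T}
    (h : (fanGraph g T).Edge p (ObNode.node (.y, j))) : p ∈ ObNode.node '' yCond T j.1 := by
  obtain ⟨κ, i⟩ := p
  rcases κ with _ | κ <;> try cases κ
  all_goals simp [fanGraph, FanEdge, ObNode.node] at h
  all_goals
    refine ⟨(_, i), ?_, rfl⟩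
    simp [yCond, atTime, h]

/-! The laws of the observed variables -/

section observed

variable {g : GraphKind} {T : ℕ} {U : Type u} {O : Ob → Type u} [MeasurableSpace U]
  [∀ o, MeasurableSpace (O o)]

/-- The observed part of an assignment of values to all nodes. -/
def observed (a : ∀ n : Node T, Val U O n.1) (n : ObNode T) : O n.1 := a n.node

theorem measurable_observed :
    Measurable (observed : (∀ n : Node T, Val U O n.1) → ∀ n : ObNode T, O n.1) :=
  measurable_pi_lambda _ fun n => measurable_pi_apply (ObNode.node n)

omit [MeasurableSpace U] [∀ o, MeasurableSpace (O o)] in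
theorem observed_preimage_agreeOn (a : ∀ n : Node T, Val U O n.1) (B : Set (ObNode T)) :
    observed ⁻¹' agreeOn (observed a) B = agreeOn a (ObNode.node '' B) := by
  ext ω
  exact (Set.forall_mem_image (p := fun n => ω n = a n)).symm

namespace FanSCM

instance (M : FanSCM.{u, v} g T U O) (I : ∀ n : Node T, Option (Val U O n.1)) :
    IsProbabilityMeasure (FanSCM.lawOf M I) :=
  Measure.isProbabilityMeasure_map (measurable_observed (U := U) (O := O)).aemeasurable

variable [∀ o, MeasurableSingletonClass (O o)] [∀ o, Countable (O o)]

theorem lawOf_agreeOn (M : FanSCM.{u, v} g T U O) (I : ∀ n : Node T, Option (Val U O n.1))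
    (a : ∀ n : Node T, Val U O n.1) (B : Set (ObNode T)) :
    lawOf M I (agreeOn (observed a) B) = M.law I (agreeOn a (ObNode.node '' B)) := by
  rw [← observed_preimage_agreeOn]
  -- A finite product of countable discrete spaces: every set is measurable.
  exact Measure.map_apply measurable_observed (MeasurableSet.of_discrete)

omit [∀ o, Countable (O o)] in
theorem measurableSet_singleton_node (a : ∀ n : Node T, Val U O n.1) (n : ObNode T) :
    MeasurableSet {a n.node} :=
  measurableSet_singleton (α := O n.1) (a n.node)

theorem lawOf_agreeOn_insert (M : FanSCM.{u, v} g T U O) {I : ∀ n : Node T, Option (Val U O n.1)}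
    (a : ∀ n : Node T, Val U O n.1) {D : Set (Node T)} {B : Set (ObNode T)}
    (hD : (fanGraph g T).IsAncestral D) {n : ObNode T} (hn : n.node ∉ D) (hI : I n.node = none)
    (hBD : ∀ m ∈ B, m.node ∈ D)
    (hpar : ∀ p, (fanGraph g T).Edge p n.node → p ∈ ObNode.node '' B) :
    lawOf M I (agreeOn (observed a) (insert n B)) =
      lawOf M I (agreeOn (observed a) B) * M.kernel a n.node := by
  rw [lawOf_agreeOn, lawOf_agreeOn, Set.image_insert_eq]
  exact M.law_agreeOn_insert a hD hn hI (Set.image_subset_iff.2 hBD) hpar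
    (Set.forall_mem_image.2 fun m _ => measurableSet_singleton_node a m)
    (measurableSet_singleton_node a n)

theorem lawOf_insert_z (M : FanSCM.{u, v} g T U O) {I : ∀ n : Node T, Option (Val U O n.1)}
    (a : ∀ n : Node T, Val U O n.1) {B : Set (ObNode T)} {j : Time T}
    (hI : I (.obs .z, j) = none) (hpar : zCond T j.1 ⊆ B)
    (hB : ∀ n ∈ B, n.1 = .z ∨ n.1 = .y → n.2.1 < j.1) :
    lawOf M I (agreeOn (observed a) (insert (.z, j) B)) =
      lawOf M I (agreeOn (observed a) B) * M.kernel a (.obs .z, j) := by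
  refine lawOf_agreeOn_insert M a (isAncestral_response g T j.1 j.1 le_rfl (by omega)) ?_ hI ?_
    fun p hp => Set.image_mono hpar (mem_zCond_of_edge hp)
  · simp [ObNode.node]
  · intro m hm
    have := hB m hm
    simp [ObNode.node] at this ⊢
    tauto

theorem lawOf_insert_y (M : FanSCM.{u, v} g T U O) {I : ∀ n : Node T, Option (Val U O n.1)}
    (a : ∀ n : Node T, Val U O n.1) {B : Set (ObNode T)} {j : Time T}
    (hI : I (.obs .y, j) = none) (hpar : yCond T j.1 ⊆ B)
    (hB : ∀ n ∈ B, (n.1 = .z → n.2.1 ≤ j.1) ∧ (n.1 = .y → n.2.1 < j.1)) :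
    lawOf M I (agreeOn (observed a) (insert (.y, j) B)) =
      lawOf M I (agreeOn (observed a) B) * M.kernel a (.obs .y, j) := by
  -- The cut-off for `z` is one later than for `y`, since `z_j` is a parent of `y_j`.
  refine lawOf_agreeOn_insert M a (isAncestral_response g T (j.1 + 1) j.1 (by omega) le_rfl) ?_ hI
    ?_ fun p hp => Set.image_mono hpar (mem_yCond_of_edge hp)
  · simp [ObNode.node]
  · intro m hm
    have := hB m hm
    simp [ObNode.node] at this ⊢
    tauto

/-! ### Factorisation over the intervention window -/

/-- The probability of the values `a` of `z` and `y` at time `j` given their parents. -/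
def stepKernel (M : FanSCM.{u, v} g T U O) (a : ∀ n : Node T, Val U O n.1) (j : ℕ) : ENNReal :=
  if h : j ∈ Finset.Icc 1 T then
    M.kernel a (.obs .z, ⟨j, h⟩) * M.kernel a (.obs .y, ⟨j, h⟩)
  else 1

/-- `x_{t:t+k}`, `C` and the states and responses at the times `t, …, s - 1`. -/
def window (T t k s : ℕ) : Set (ObNode T) :=
  xWin T t k ∪ adjSet T t k ∪ {n | (n.1 = .z ∨ n.1 = .y) ∧ t ≤ n.2.1 ∧ n.2.1 < s}

theorem window_self (T t k : ℕ) : window T t k t = xWin T t k ∪ adjSet T t k := by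
  refine Set.union_eq_self_of_subset_right ?_
  rintro n ⟨-, h, h'⟩
  omega

theorem window_succ {T t k j : ℕ} (htj : t ≤ j) (hj : j ∈ Finset.Icc 1 T) :
    window T t k (j + 1) = insert (.y, ⟨j, hj⟩) (insert (.z, ⟨j, hj⟩) (window T t k j)) := by
  ext ⟨o, i, hi⟩
  cases o <;> simp [window, xWin, adjSet, past, Subtype.ext_iff]
  all_goals omega

theorem window_end {T t k : ℕ} : window T t k (t + k + 1) =
    xWin T t k ∪ adjSet T t k ∪ midSet T t k ∪ atTime T .y (t + k) ∪ atTime T .z (t + k) := by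
  ext ⟨o, i, hi⟩
  cases o <;> simp [window, xWin, adjSet, past, midSet, atTime]
  all_goals omega

/-- At `j = t` the lagged `z` and `y` come from `C`; later they come from the previous step of the
window. -/
theorem zCond_subset_window {T t k j : ℕ} (htj : t ≤ j) (hj : j ≤ t + k) :
    zCond T j ⊆ window T t k j := by
  rintro ⟨o, i, hi⟩
  cases o <;> simp [zCond, window, xWin, adjSet, past, atTime]
  all_goals omega

theorem yCond_subset_insert_window {T t k j : ℕ} (htj : t ≤ j) (hj : j ≤ t + k)
    (hjT : j ∈ Finset.Icc 1 T) :
    yCond T j ⊆ insert (.z, ⟨j, hjT⟩) (window T t k j) := by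
  rintro ⟨o, i, hi⟩
  cases o <;> simp [yCond, window, xWin, adjSet, past, atTime, Subtype.ext_iff]
  all_goals omega

theorem lt_of_mem_window {T t k j : ℕ} (htj : t ≤ j) {n : ObNode T} (hn : n ∈ window T t k j)
    (h : n.1 = .z ∨ n.1 = .y) : n.2.1 < j := by
  obtain ⟨o, i, hi⟩ := n
  cases o <;> simp [window, xWin, adjSet, past] at hn h ⊢
  all_goals omega

/-- The law of the window factorises into the law of `x_{t:t+k}` and `C` and the kernels of the
states and responses, under every intervention that leaves states and responses alone. -/
theorem lawOf_window (M : FanSCM.{u, v} g T U O) {I : ∀ n : Node T, Option (Val U O n.1)}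
    (hz : ∀ j, I (.obs .z, j) = none) (hy : ∀ j, I (.obs .y, j) = none)
    (a : ∀ n : Node T, Val U O n.1) {t k : ℕ} (ht : 1 ≤ t) (htk : t + k ≤ T) {s : ℕ}
    (hts : t ≤ s) (hs : s ≤ t + k + 1) :
    lawOf M I (agreeOn (observed a) (window T t k s)) =
      lawOf M I (agreeOn (observed a) (xWin T t k ∪ adjSet T t k)) *
        ∏ j ∈ Finset.Ico t s, stepKernel M a j := by
  induction s, hts using Nat.le_induction with
  | base => simp [window_self]
  | succ j htj ih =>
    have hj : j ∈ Finset.Icc 1 T := Finset.mem_Icc.2 ⟨by omega, by omega⟩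
    rw [window_succ htj hj, lawOf_insert_y M a (hy _)
      (yCond_subset_insert_window htj (by omega) hj) ?_, lawOf_insert_z M a (hz _)
      (zCond_subset_window (j := j) htj (by omega)) fun n hn => lt_of_mem_window htj hn, ih (by omega),
      Finset.prod_Ico_succ_top htj, stepKernel, dif_pos hj]
    · ring
    · rintro n (rfl | hn)
      · simp
      · exact ⟨fun h => (lt_of_mem_window htj hn (.inl h)).le,
          fun h => lt_of_mem_window htj hn (.inr h)⟩

end FanSCM

end observed

/-! Assignments to sets of observed variables -/

section assignments

variable {T : ℕ} {O : Ob → Type u}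

theorem ev_eq_agreeOn {A : Set (ObNode T)} {b : Asg O A} {a : ∀ n : ObNode T, O n.1}
    (h : a ∈ ev b) : ev b = agreeOn a A := by
  ext ω
  exact ⟨fun hω n hn => (hω ⟨n, hn⟩).trans (h ⟨n, hn⟩).symm,
    fun hω n => (hω n n.2).trans (h n)⟩

theorem evOn_eq_agreeOn {A : Set (ObNode T)} {b : Asg O A} {a : ∀ n : ObNode T, O n.1}
    (h : a ∈ ev b) (B : Set (ObNode T)) : evOn b B = agreeOn a (A ∩ B) := by
  ext ω
  exact ⟨fun hω n hn => (hω ⟨n, hn.1⟩ hn.2).trans (h ⟨n, hn.1⟩).symm,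
    fun hω n hn => (hω n ⟨n.2, hn⟩).trans (h n)⟩

/-- Assignments to disjoint sets of variables have a common extension. -/
theorem exists_mem_ev_of_disjoint {A B : Set (ObNode T)} (hAB : Disjoint A B) (b : Asg O B)
    (a : ∀ n : ObNode T, O n.1) :
    ∃ a' : ∀ n : ObNode T, O n.1, a' ∈ ev b ∧ ∀ n ∈ A, a' n = a n := by
  classical
  exact ⟨fun n => if h : n ∈ B then b ⟨n, h⟩ else a n, fun n => dif_pos n.2,
    fun n hn => dif_neg (Set.disjoint_left.1 hAB hn)⟩

/-- The five index sets are pairwise disjoint, so `a₀` can be overwritten on them in turn. All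
events and kernels can then refer to one global assignment. -/
theorem exists_mem_ev (a₀ : ∀ n : ObNode T, O n.1) {t k : ℕ} (x : Asg O (xWin T t k))
    (c : Asg O (adjSet T t k)) (m : Asg O (midSet T t k))
    (y : Asg O (atTime T .y (t + k))) (z : Asg O (atTime T .z (t + k))) :
    ∃ a : ∀ n : ObNode T, O n.1, a ∈ ev x ∧ a ∈ ev c ∧ a ∈ ev m ∧ a ∈ ev y ∧ a ∈ ev z := by
  obtain ⟨a₁, h₁, -⟩ := exists_mem_ev_of_disjoint (Set.empty_disjoint _) x a₀
  obtain ⟨a₂, h₂, e₂⟩ := exists_mem_ev_of_disjoint (A := xWin T t k) (by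
    rw [Set.disjoint_left]
    rintro ⟨o, i, hi⟩
    cases o <;> simp [xWin, adjSet, past]
    all_goals omega) c a₁
  obtain ⟨a₃, h₃, e₃⟩ := exists_mem_ev_of_disjoint (A := xWin T t k ∪ adjSet T t k) (by
    rw [Set.disjoint_left]
    rintro ⟨o, i, hi⟩
    cases o <;> simp [xWin, adjSet, past, midSet]
    all_goals omega) m a₂
  obtain ⟨a₄, h₄, e₄⟩ := exists_mem_ev_of_disjoint
    (A := xWin T t k ∪ adjSet T t k ∪ midSet T t k) (by
    rw [Set.disjoint_left]
    rintro ⟨o, i, hi⟩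
    cases o <;> simp [xWin, adjSet, past, midSet, atTime]
    all_goals omega) y a₃
  obtain ⟨a₅, h₅, e₅⟩ := exists_mem_ev_of_disjoint
    (A := xWin T t k ∪ adjSet T t k ∪ midSet T t k ∪ atTime T .y (t + k)) (by
    rw [Set.disjoint_left]
    rintro ⟨o, i, hi⟩
    cases o <;> simp [xWin, adjSet, past, midSet, atTime]
    all_goals omega) z a₄
  refine ⟨a₅, fun n => ?_, fun n => ?_, fun n => ?_, fun n => ?_, h₅⟩
  · rw [e₅ n (.inl (.inl (.inl n.2))), e₄ n (.inl (.inl n.2)), e₃ n (.inl n.2), e₂ n n.2, h₁ n]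
  · rw [e₅ n (.inl (.inl (.inr n.2))), e₄ n (.inl (.inr n.2)), e₃ n (.inr n.2), h₂ n]
  · rw [e₅ n (.inl (.inr n.2)), e₄ n (.inr n.2), h₃ n]
  · rw [e₅ n (.inr n.2), h₄ n]

theorem fixOn_eq_agreeOn {t k : ℕ} {x : Asg O (xWin T t k)}
    {c : Asg O (adjSet T t k)} {m : Asg O (midSet T t k)}
    {y : Asg O (atTime T .y (t + k))} {z : Asg O (atTime T .z (t + k))}
    {a : ∀ n : ObNode T, O n.1} (hx : a ∈ ev x) (hc : a ∈ ev c) (hm : a ∈ ev m) (hy : a ∈ ev y)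
    (hz : a ∈ ev z) {B : Set (ObNode T)} (hB : B ⊆ FanSCM.window T t k (t + k + 1)) :
    fixOn x c m y z B = agreeOn a B := by
  rw [fixOn, evOn_eq_agreeOn hx, evOn_eq_agreeOn hc, evOn_eq_agreeOn hm, evOn_eq_agreeOn hy,
    evOn_eq_agreeOn hz, ← agreeOn_union, ← agreeOn_union, ← agreeOn_union, ← agreeOn_union,
    ← Set.union_inter_distrib_right, ← Set.union_inter_distrib_right,
    ← Set.union_inter_distrib_right, ← Set.union_inter_distrib_right, ← FanSCM.window_end,
    Set.inter_eq_self_of_subset_right hB]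

variable [∀ o, MeasurableSpace (O o)] [∀ o, MeasurableSingletonClass (O o)]
  [∀ o, Countable (O o)]

/-- Law of total probability over the values of the variables in `A`. -/
theorem measure_eq_tsum_inter_ev (p : Measure (∀ n : ObNode T, O n.1)) (A : Set (ObNode T))
    (S : Set (∀ n : ObNode T, O n.1)) : p S = ∑' b : Asg O A, p (S ∩ ev b) := by
  have h : ⋃ b : Asg O A, ev b = Set.univ :=
    Set.iUnion_eq_univ_iff.2 fun ω => ⟨fun n => ω n, fun n => rfl⟩
  rw [← measure_iUnion _ fun b => MeasurableSet.of_discrete, ← Set.inter_iUnion, h,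
    Set.inter_univ]
  intro b b' hbb'
  refine Set.disjoint_left.2 fun ω hω hω' => hbb' (funext fun n => ?_)
  exact (hω.2 n).symm.trans (hω'.2 n)

end assignments

/-! The adjustment formulas -/

namespace FanSCM

theorem yCond_subset_window_end {T t k j : ℕ} (htj : t ≤ j) (hj : j ≤ t + k) :
    yCond T j ⊆ window T t k (t + k + 1) := by
  rintro ⟨o, i, hi⟩
  cases o <;> simp [yCond, window, xWin, adjSet, past, atTime]
  all_goals omega

theorem zCond_subset_window_end {T t k j : ℕ} (htj : t ≤ j) (hj : j ≤ t + k) :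
    zCond T j ⊆ window T t k (t + k + 1) := by
  rintro ⟨o, i, hi⟩
  cases o <;> simp [zCond, window, xWin, adjSet, past, atTime]
  all_goals omega

theorem atTime_y_subset_window_end {T t k j : ℕ} (htj : t ≤ j) (hj : j ≤ t + k) :
    atTime T .y j ⊆ window T t k (t + k + 1) := by
  rintro ⟨o, i, hi⟩
  cases o <;> simp [atTime, window, xWin, adjSet, past]
  all_goals omega

theorem atTime_z_subset_window_end {T t k j : ℕ} (htj : t ≤ j) (hj : j ≤ t + k) :
    atTime T .z j ⊆ window T t k (t + k + 1) := by
  rintro ⟨o, i, hi⟩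
  cases o <;> simp [atTime, window, xWin, adjSet, past]
  all_goals omega

variable {T : ℕ} {U : Type u} {O : Ob → Type u}

theorem intervene_eq_none {A : Set (ObNode T)} (b : Asg O A) {n : ObNode T} (hn : n ∉ A) :
    intervene U b n.node = none := by
  obtain ⟨o, i⟩ := n
  exact dif_neg hn

theorem intervene_eq_some {A : Set (ObNode T)} (b : Asg O A) (n : A) :
    intervene U b n.1.node = some (b n) := by
  obtain ⟨⟨o, i⟩, hn⟩ := n
  exact dif_pos hn

variable {g : GraphKind} [MeasurableSpace U] [∀ o, MeasurableSpace (O o)]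

/-- For all values of `C` and of the intermediate states and responses there is an assignment of
values to all nodes that extends them. -/
theorem exists_extension (M : FanSCM.{u, v} g T U O) {t k : ℕ} (x : Asg O (xWin T t k))
    (y : Asg O (atTime T .y (t + k))) (z : Asg O (atTime T .z (t + k))) :
    ∃ a : Asg O (adjSet T t k) → Asg O (midSet T t k) → ∀ n : Node T, Val U O n.1,
      ∀ c m, observed (a c m) ∈ ev x ∧ observed (a c m) ∈ ev c ∧ observed (a c m) ∈ ev m ∧
        observed (a c m) ∈ ev y ∧ observed (a c m) ∈ ev z := by
  -- `ω₀` only supplies arbitrary values for `u` and for variables that none of the five assignments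
  -- fixes.
  obtain ⟨ω₀⟩ := nonempty_of_isProbabilityMeasure (M.law fun _ => none)
  choose a ha using fun c m => exists_mem_ev (observed ω₀) x c m y z
  exact ⟨fun c m n => match n with
    | (.u, i) => ω₀ (.u, i)
    | (.obs o, i) => a c m (o, i), ha⟩

variable [∀ o, MeasurableSingletonClass (O o)] [∀ o, Countable (O o)]

/-- All laws live on the same noise space, so laws under different interventions can be compared for
each fixed noise value. -/
theorem lawOf_apply (M : FanSCM.{u, v} g T U O) (I : ∀ n : Node T, Option (Val U O n.1))
    (S : Set (∀ n : ObNode T, O n.1)) :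
    lawOf M I S = Measure.pi M.noiseLaw {ε | observed (M.solve I ε) ∈ S} := by
  have h : lawOf M I S = M.law I (observed ⁻¹' S) :=
    Measure.map_apply measurable_observed MeasurableSet.of_discrete
  rw [h, SCM.law, Measure.map_apply (M.measurable_solve I)
    (measurable_observed MeasurableSet.of_discrete)]
  rfl

/-- The intervened variables have the prescribed values. -/
theorem doLaw_inter_ev (M : FanSCM.{u, v} g T U O) {A : Set (ObNode T)} (b : Asg O A)
    (S : Set (∀ n : ObNode T, O n.1)) : doLaw M b (S ∩ ev b) = doLaw M b S := by
  rw [doLaw, lawOf_apply, lawOf_apply]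
  congr 1
  ext ε
  refine and_iff_left fun n => ?_
  rw [observed, SCM.solve_eq, intervene_eq_some]
  rfl

/-- An intervention on `x_{t:t+k}` does not change the law of `C`. -/
theorem doLaw_ev_adjSet (M : FanSCM.{u, v} g T U O) {t k : ℕ} (x : Asg O (xWin T t k))
    (c : Asg O (adjSet T t k)) : doLaw M x (ev c) = obsLaw M (ev c) := by
  rw [doLaw, obsLaw, lawOf_apply, lawOf_apply]
  congr 1
  ext ε
  refine forall_congr' fun n => ?_
  have h : M.solve (intervene U x) ε n.1.node = M.solve (fun _ => none) ε n.1.node := by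
    refine M.solve_congr (isAncestral_treatment g T t) ?_ (fun _ _ => rfl) ?_
    · rintro ⟨_ | o, i⟩ hn
      · rfl
      · refine intervene_eq_none x (n := (o, i)) fun hx => ?_
        have := hn (.inl (congrArg Var.obs hx.1))
        exact absurd hx.2.1 (not_le.2 this)
    · obtain ⟨⟨o, i, hi⟩, hn⟩ := n
      cases o <;> simp [adjSet, past, ObNode.node] at hn ⊢
      all_goals omega
  rw [observed, observed, h]

variable (M : FanSCM.{u, v} g T U O) {t k : ℕ} {x : Asg O (xWin T t k)}
  {y : Asg O (atTime T .y (t + k))} {z : Asg O (atTime T .z (t + k))}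
variable {a : Asg O (adjSet T t k) → Asg O (midSet T t k) → ∀ n : Node T, Val U O n.1}
  (ha : ∀ c m, observed (a c m) ∈ ev x ∧ observed (a c m) ∈ ev c ∧ observed (a c m) ∈ ev m ∧
        observed (a c m) ∈ ev y ∧ observed (a c m) ∈ ev z)
include ha

/-- This is `lawOf_window` summed over the intermediate states and responses; it serves both the
observational and the interventional law. -/
theorem lawOf_inter_ev {I : ∀ n : Node T, Option (Val U O n.1)}
    (hIz : ∀ j, I (.obs .z, j) = none) (hIy : ∀ j, I (.obs .y, j) = none) (ht : 1 ≤ t)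
    (htk : t + k ≤ T) (c : Asg O (adjSet T t k)) :
    lawOf M I (ev y ∩ ev z ∩ (ev x ∩ ev c)) =
      lawOf M I (ev x ∩ ev c) *
        ∑' m, ∏ j ∈ Finset.Icc t (t + k), stepKernel M (a c m) j := by
  rw [measure_eq_tsum_inter_ev (lawOf M I) (midSet T t k), ← ENNReal.tsum_mul_left]
  refine tsum_congr fun m => ?_
  obtain ⟨hx, hc, hm, hy, hz⟩ := ha c m
  have hw : ev y ∩ ev z ∩ (ev x ∩ ev c) ∩ ev m =
      agreeOn (observed (a c m)) (window T t k (t + k + 1)) := by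
    rw [window_end, agreeOn_union, agreeOn_union, agreeOn_union, agreeOn_union,
      ← ev_eq_agreeOn hx, ← ev_eq_agreeOn hc, ← ev_eq_agreeOn hm, ← ev_eq_agreeOn hy,
      ← ev_eq_agreeOn hz]
    ext ω
    simp only [Set.mem_inter_iff]
    tauto
  rw [hw, lawOf_window M hIz hIy _ ht htk (by omega) le_rfl, agreeOn_union, ← ev_eq_agreeOn hx,
    ← ev_eq_agreeOn hc]
  -- `Finset.Ico t (t + k + 1)` and `Finset.Icc t (t + k)` agree definitionally.
  rfl

theorem doLaw_eq_tsum (ht : 1 ≤ t) (htk : t + k ≤ T) :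
    doLaw M x (ev y ∩ ev z) = ∑' c : Asg O (adjSet T t k),
      (∑' m, ∏ j ∈ Finset.Icc t (t + k), stepKernel M (a c m) j) * obsLaw M (ev c) := by
  rw [measure_eq_tsum_inter_ev (doLaw M x) (adjSet T t k)]
  refine tsum_congr fun c => ?_
  have hz : ∀ j, intervene U x (.obs .z, j) = none := fun j =>
    intervene_eq_none x (n := (.z, j)) (by simp [xWin])
  have hy : ∀ j, intervene U x (.obs .y, j) = none := fun j =>
    intervene_eq_none x (n := (.y, j)) (by simp [xWin])
  have h := lawOf_inter_ev M ha hz hy ht htk c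
  rw [Set.inter_comm (ev x), ← Set.inter_assoc] at h
  rw [← doLaw_inter_ev, ← doLaw_ev_adjSet M x, ← doLaw_inter_ev M x (ev c), mul_comm]
  exact h

theorem backdoor_eq_tsum (ht : 1 ≤ t) (htk : t + k ≤ T)
    (hpos : ∀ c : Asg O (adjSet T t k), obsLaw M (ev c) ≠ 0 → obsLaw M (ev x ∩ ev c) ≠ 0) :
    backdoor (obsLaw M) t k x y z = ∑' c : Asg O (adjSet T t k),
      (∑' m, ∏ j ∈ Finset.Icc t (t + k), stepKernel M (a c m) j) * obsLaw M (ev c) := by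
  refine tsum_congr fun c => ?_
  rcases eq_or_ne (obsLaw M (ev c)) 0 with h0 | h0
  · rw [h0, mul_zero, mul_zero]
  · have h := lawOf_inter_ev M ha (I := fun _ => none) (fun _ => rfl) (fun _ => rfl) ht htk c
    rw [cond_apply MeasurableSet.of_discrete, obsLaw, Set.inter_comm (ev x ∩ ev c), h]
    exact congrArg (· * _)
      (ENNReal.inv_mul_cancel_left (hpos c h0) (measure_ne_top (lawOf M _) _))

/-- The conditional probabilities in the adjustment formula are the kernels, unless the
conditioning events are null events. -/
theorem cond_mul_cond_eq_stepKernel (ht : 1 ≤ t) (htk : t + k ≤ T) (c : Asg O (adjSet T t k))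
    (m : Asg O (midSet T t k)) {j : ℕ} (hj : j ∈ Finset.Icc t (t + k))
    (hY : obsLaw M (agreeOn (observed (a c m)) (yCond T j)) ≠ 0)
    (hZ : obsLaw M (agreeOn (observed (a c m)) (zCond T j)) ≠ 0) :
    (obsLaw M)[fixOn x c m y z (atTime T .y j) | fixOn x c m y z (yCond T j)] *
      (obsLaw M)[fixOn x c m y z (atTime T .z j) | fixOn x c m y z (zCond T j)] =
      stepKernel M (a c m) j := by
  obtain ⟨hx, hc, hm, hy, hz⟩ := ha c m
  obtain ⟨htj, hjk⟩ := Finset.mem_Icc.1 hj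
  have hjT : j ∈ Finset.Icc 1 T := Finset.mem_Icc.2 ⟨by omega, by omega⟩
  have hyat : atTime T .y j = {(.y, ⟨j, hjT⟩)} := by
    ext n
    simp [atTime, Prod.ext_iff, Subtype.ext_iff]
  have hzat : atTime T .z j = {(.z, ⟨j, hjT⟩)} := by
    ext n
    simp [atTime, Prod.ext_iff, Subtype.ext_iff]
  -- With `B` the bare parent set, the one-step rule says that the kernel is the conditional
  -- probability.
  have hYi := lawOf_insert_y M (I := fun _ => none) (a c m) (j := ⟨j, hjT⟩) rfl subset_rfl (by
    rintro ⟨o, i, hi⟩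
    cases o <;> simp [yCond, atTime]
    all_goals omega)
  have hZi := lawOf_insert_z M (I := fun _ => none) (a c m) (j := ⟨j, hjT⟩) rfl subset_rfl (by
    rintro ⟨o, i, hi⟩
    cases o <;> simp [zCond, atTime]
    all_goals omega)
  rw [cond_apply MeasurableSet.of_discrete, cond_apply MeasurableSet.of_discrete,
    fixOn_eq_agreeOn hx hc hm hy hz (yCond_subset_window_end htj hjk),
    fixOn_eq_agreeOn hx hc hm hy hz (zCond_subset_window_end htj hjk),
    fixOn_eq_agreeOn hx hc hm hy hz (atTime_y_subset_window_end htj hjk),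
    fixOn_eq_agreeOn hx hc hm hy hz (atTime_z_subset_window_end htj hjk),
    ← agreeOn_union, ← agreeOn_union, hyat, hzat, Set.union_singleton, Set.union_singleton]
  rw [obsLaw] at hY hZ ⊢
  rw [hYi, hZi, ENNReal.inv_mul_cancel_left hY (measure_ne_top _ _),
    ENNReal.inv_mul_cancel_left hZ (measure_ne_top _ _), stepKernel, dif_pos hjT, mul_comm]

/-- The delicate point is null conditioning events, where the conditional reads `0` but the kernel
need not vanish. The products agree nevertheless. -/
theorem seqAdjust_eq_tsum (ht : 1 ≤ t) (htk : t + k ≤ T)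
    (hpos : ∀ c : Asg O (adjSet T t k), obsLaw M (ev c) ≠ 0 → obsLaw M (ev x ∩ ev c) ≠ 0) :
    seqAdjust (obsLaw M) t k x y z = ∑' c : Asg O (adjSet T t k),
      (∑' m, ∏ j ∈ Finset.Icc t (t + k), stepKernel M (a c m) j) * obsLaw M (ev c) := by
  refine tsum_congr fun c => ?_
  rcases eq_or_ne (obsLaw M (ev c)) 0 with h0 | h0
  · rw [h0, mul_zero, mul_zero]
  congr 1
  refine tsum_congr fun m => ?_
  have hw := lawOf_window M (I := fun _ => none) (fun _ => rfl) (fun _ => rfl) (a c m) ht htk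
    (s := t + k + 1) (by omega) le_rfl
  have hm := ha c m
  have hYw {j : ℕ} (hj : j ∈ Finset.Icc t (t + k)) : yCond T j ⊆ window T t k (t + k + 1) :=
    yCond_subset_window_end (Finset.mem_Icc.1 hj).1 (Finset.mem_Icc.1 hj).2
  have hZw {j : ℕ} (hj : j ∈ Finset.Icc t (t + k)) : zCond T j ⊆ window T t k (t + k + 1) :=
    zCond_subset_window_end (Finset.mem_Icc.1 hj).1 (Finset.mem_Icc.1 hj).2
  by_cases hp : obsLaw M (agreeOn (observed (a c m)) (window T t k (t + k + 1))) = 0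
  -- As `p(x, C) > 0`, a null window forces some step kernel to be `0`. At that `j` the conditional
  -- factor is also `0`: either a conditioning event is null, or the factor equals the kernel.
  · have hxc : obsLaw M (agreeOn (observed (a c m)) (xWin T t k ∪ adjSet T t k)) ≠ 0 := by
      rw [agreeOn_union, ← ev_eq_agreeOn hm.1, ← ev_eq_agreeOn hm.2.1]
      exact hpos c h0
    have hprod : ∏ j ∈ Finset.Icc t (t + k), stepKernel M (a c m) j = 0 :=
      (mul_eq_zero.1 (hw.symm.trans hp)).resolve_left hxc
    obtain ⟨j, hj, hj0⟩ := Finset.prod_eq_zero_iff.1 hprod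
    rw [hprod]
    refine Finset.prod_eq_zero hj ?_
    by_cases hY : obsLaw M (agreeOn (observed (a c m)) (yCond T j)) = 0
    · rw [fixOn_eq_agreeOn hm.1 hm.2.1 hm.2.2.1 hm.2.2.2.1 hm.2.2.2.2 (hYw hj),
        cond_eq_zero_of_meas_eq_zero hY, Measure.coe_zero, Pi.zero_apply, zero_mul]
    by_cases hZ : obsLaw M (agreeOn (observed (a c m)) (zCond T j)) = 0
    · rw [fixOn_eq_agreeOn hm.1 hm.2.1 hm.2.2.1 hm.2.2.2.1 hm.2.2.2.2 (hZw hj),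
        cond_eq_zero_of_meas_eq_zero hZ, Measure.coe_zero, Pi.zero_apply, mul_zero]
    rw [cond_mul_cond_eq_stepKernel M ha ht htk c m hj hY hZ, hj0]
  · exact Finset.prod_congr rfl fun j hj => cond_mul_cond_eq_stepKernel M ha ht htk c m hj
      (fun h => hp (measure_mono_null (agreeOn_anti _ (hYw hj)) h))
      (fun h => hp (measure_mono_null (agreeOn_anti _ (hZw hj)) h))

end FanSCM

end

theorem proposition2 (g : GraphKind) (T t k : ℕ) (ht : 1 ≤ t) (htk : t + k ≤ T)
    {U : Type u} {O : Ob → Type u} [MeasurableSpace U]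
    [∀ o, MeasurableSpace (O o)] [∀ o, MeasurableSingletonClass (O o)] [∀ o, Countable (O o)]
    (M : FanSCM.{u, v} g T U O) (x : Asg O (xWin T t k))
    (hpos : ∀ c : Asg O (adjSet T t k),
      FanSCM.obsLaw M (ev c) ≠ 0 → FanSCM.obsLaw M (ev x ∩ ev c) ≠ 0) :
    -- the joint effect equals both expressions in the observational law
    (∀ (y : Asg O (atTime T .y (t + k))) (z : Asg O (atTime T .z (t + k))),
      FanSCM.doLaw M x (ev y ∩ ev z) = backdoor (FanSCM.obsLaw M) t k x y z ∧
      backdoor (FanSCM.obsLaw M) t k x y z = seqAdjust (FanSCM.obsLaw M) t k x y z) ∧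
    -- identifiability: models with the same observational law have the same joint effect
    (∀ (U' : Type u) [MeasurableSpace U'] (M' : FanSCM.{u, v} g T U' O),
      FanSCM.obsLaw M' = FanSCM.obsLaw M →
      ∀ (y : Asg O (atTime T .y (t + k))) (z : Asg O (atTime T .z (t + k))),
        FanSCM.doLaw M' x (ev y ∩ ev z) = FanSCM.doLaw M x (ev y ∩ ev z)) ∧
    -- the marginal effect
    (∀ y : Asg O (atTime T .y (t + k)),
      FanSCM.doLaw M x (ev y) =
        ∑' z : Asg O (atTime T .z (t + k)), FanSCM.doLaw M x (ev y ∩ ev z)) ∧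
    -- the state-conditional effect
    (∀ (y : Asg O (atTime T .y (t + k))) (z : Asg O (atTime T .z (t + k))),
      (FanSCM.doLaw M x)[ev y | ev z] =
        FanSCM.doLaw M x (ev y ∩ ev z) /
          ∑' y' : Asg O (atTime T .y (t + k)), FanSCM.doLaw M x (ev y' ∩ ev z)) := by
  -- Stated for every model, since identifiability needs it for `M'` too; positivity passes to `M'`
  -- because it concerns the observational law only.
  have key : ∀ {U' : Type u} [MeasurableSpace U'] (M' : FanSCM.{u, v} g T U' O),
      (∀ c : Asg O (adjSet T t k),
        FanSCM.obsLaw M' (ev c) ≠ 0 → FanSCM.obsLaw M' (ev x ∩ ev c) ≠ 0) →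
      ∀ (y : Asg O (atTime T .y (t + k))) (z : Asg O (atTime T .z (t + k))),
      FanSCM.doLaw M' x (ev y ∩ ev z) = backdoor (FanSCM.obsLaw M') t k x y z ∧
      backdoor (FanSCM.obsLaw M') t k x y z = seqAdjust (FanSCM.obsLaw M') t k x y z := by
    intro U' _ M' hpos' y z
    obtain ⟨a, ha⟩ := FanSCM.exists_extension M' x y z
    rw [FanSCM.doLaw_eq_tsum M' ha ht htk, FanSCM.backdoor_eq_tsum M' ha ht htk hpos',
      FanSCM.seqAdjust_eq_tsum M' ha ht htk hpos']
    exact ⟨rfl, rfl⟩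
  refine ⟨key M hpos, fun U' _ M' h y z => ?_, fun y => measure_eq_tsum_inter_ev _ _ _,
    fun y z => ?_⟩
  · rw [(key M hpos y z).1, (key M' (by rwa [h]) y z).1, h]
  · rw [cond_apply MeasurableSet.of_discrete, Set.inter_comm,
      measure_eq_tsum_inter_ev (FanSCM.doLaw M x) (atTime T .y (t + k)) (ev z), mul_comm,
      ENNReal.div_eq_inv_mul, mul_comm]
    simp_rw [Set.inter_comm (ev z)]
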